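/- For integers $N,d\ge 0$ write $\binom{N}{\le d}=\binom N0+\binom N1+\dots+\binom Nd$. For a vector $x=(x_1,\dots,x_n)\in\mathbb R^n$ let $x^{\le d}\in\mathbb R^{\binom{n}{\le d}}$ be the vector whose coordinates are indexed by the subsets $I\subseteq\{1,\dots,n\}$ with $|I|\le d$, with $(x^{\le d})_I=\prod_{i\in I}x_i$ (the empty product being $1$). There is an absolute constant $C>0$ such that the following holds. Let $n,d,m$ be positive integers and let $t$ be a real number such that $$ d\,n^{0.02}\le t\le 0.001\,n \qquad\text{and}\qquad m<\binom{N}{\le d},\quad N=\max\Big(0,\Big\lfloor n-\frac{Cn}{\log n}-t\Big\rfloor\Big). $$ Let $x_1,\dots,x_m$ be independent random vectors, each uniformly distributed in $\{-1,1\}^n$. Then, with probability larger than $1-2^{-t/4}$, every vector of the form $u^{\le d}$ with $u\in\{-1,1\}^n$ that lies in the linear span of $x_1^{\le d},\dots,x_m^{\le d}$ over $\mathbb R$ is equal to $x_i^{\le d}$ or $-x_i^{\le d}$ for some $i\in\{1,\dots,m\}$. -/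

import Mathlib

/-- The discrete cube `{-1, 1}^n`, as a subset of `ℝ^n`. -/
def signCube (n : ℕ) : Set (Fin n → ℝ) :=
  {x | ∀ i, x i = -1 ∨ x i = 1}

/-- The binomial sum `binom(N, ≤ d) = binom(N, 0) + binom(N, 1) + ⋯ + binom(N, d)`. -/
def binomSum (N d : ℕ) : ℕ :=
  ∑ k ∈ Finset.range (d + 1), N.choose k

/-- The `d`-th power `x^{≤ d}` of a vector `x ∈ ℝ^n`: its components are indexed by all subsets
`I` of the index set with at most `d` elements, and the component at `I` is `∏ i ∈ I, x i`
(which is `1` for `I = ∅`). -/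
def powLE {n : ℕ} (d : ℕ) (x : Fin n → ℝ) : {I : Finset (Fin n) // I.card ≤ d} → ℝ :=
  fun I => ∏ i ∈ I.1, x i

/-! Two facts carry the proof, both phrased as counts of Boolean sign patterns. The first is
geometric: a subspace of dimension less than `binomSum N d` contains fewer than `2 ^ N` cube powers
(`card_powLE_mem_lt`), because among cube sets of a given size the initial segments of the binary
order span the least (`lowWeightCount_card_le_finrank`). Resampling one vector at a time, the powers
of `m` random vectors cut to `a` coordinates are dependent with probability at most `m * 2 ^ N / 2 ^
a`. The second is Littlewood–Offord: a signed sum hits `±1` with probability at most `κ`, where `κ =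
2 / √s` for `s` nonzero coefficients and `κ = 3 / 4` for two.

Suppose `powLE d u` is a combination of the powers, and these are independent on the first `a`
coordinates. Then the restriction of `u` determines the coefficients, so at most `2 ^ a` coefficient
vectors are possible before the other `q` coordinates are exposed. Each of those must give a signed
sum `±1`, which costs `2 ^ a * κ ^ q` (`card_hasCombination_le`).

With `s ≈ n ^ 0.01` nonzero coefficients, `q ≈ 10000 n / log n` is enough; this is the loss in `N`.
With between two and `s`, a union bound over `m ^ s` supports is affordable and `a ≈ n / 10` works.
A single nonzero coefficient equals `1` by the empty monomial, so it gives no new vector. -/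

open Finset Module MeasureTheory ProbabilityTheory

/-! ### Integers of low binary weight -/

/-- The number of `x < M` whose binary expansion has fewer than `e` ones. -/
def lowWeightCount (e M : ℕ) : ℕ :=
  ∑ x ∈ range M, if (Nat.digits 2 x).sum < e then 1 else 0

theorem digits_two_sum_double (x : ℕ) : (Nat.digits 2 (2 * x)).sum = (Nat.digits 2 x).sum := by
  rcases Nat.eq_zero_or_pos x with rfl | h
  · simp
  · rw [Nat.digits_def' (by norm_num) (by omega)]
    simp

theorem digits_two_sum_double_add_one (x : ℕ) :
    (Nat.digits 2 (2 * x + 1)).sum = (Nat.digits 2 x).sum + 1 := by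
  rw [Nat.digits_def' (by norm_num) (by omega)]
  have : (2 * x + 1) / 2 = x := by omega
  rw [this]
  simp [Nat.add_mod, add_comm]

theorem lowWeightCount_succ (e M : ℕ) : lowWeightCount e (M + 1) =
    lowWeightCount e M + if (Nat.digits 2 M).sum < e then 1 else 0 := by
  rw [lowWeightCount, sum_range_succ, lowWeightCount]

@[simp] theorem lowWeightCount_zero_right (e : ℕ) : lowWeightCount e 0 = 0 := by
  simp [lowWeightCount]

@[simp] theorem lowWeightCount_zero_left (M : ℕ) : lowWeightCount 0 M = 0 := by
  simp [lowWeightCount]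

theorem lowWeightCount_one (e : ℕ) : lowWeightCount (e + 1) 1 = 1 := by
  simp [lowWeightCount_succ (e + 1) 0]

theorem lowWeightCount_mono (e : ℕ) : Monotone (lowWeightCount e) :=
  monotone_nat_of_le_succ fun n => by rw [lowWeightCount_succ]; omega

/-- Split by the last binary digit; a digit one uses up one unit of weight. -/
theorem lowWeightCount_double (e M : ℕ) :
    lowWeightCount e (2 * M) = lowWeightCount e M + lowWeightCount (e - 1) M := by
  induction M with
  | zero => simp
  | succ M ih =>
    rw [show 2 * (M + 1) = 2 * M + 1 + 1 by ring, lowWeightCount_succ, lowWeightCount_succ, ih,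
      lowWeightCount_succ, lowWeightCount_succ, digits_two_sum_double,
      digits_two_sum_double_add_one]
    split_ifs <;> omega

theorem lowWeightCount_double_add_one (e M : ℕ) :
    lowWeightCount e (2 * M + 1) = lowWeightCount e (M + 1) + lowWeightCount (e - 1) M := by
  rw [lowWeightCount_succ, lowWeightCount_double, lowWeightCount_succ, digits_two_sum_double]
  ring

/-- Halving both arguments reduces the inequality to itself at levels `e` and `e - 1`. It is the
numerical half of the induction on dimension in `lowWeightCount_card_le_finrank`. -/
theorem lowWeightCount_add_le (e a b : ℕ) (hab : b ≤ a) :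
    lowWeightCount e (a + b) ≤ lowWeightCount e a + lowWeightCount (e - 1) b := by
  induction hs : a + b using Nat.strong_induction_on generalizing e a b with
  | _ s ih =>
  subst hs
  rcases Nat.eq_zero_or_pos b with rfl | hb
  · simp
  obtain ⟨a', ha | ha⟩ := Nat.even_or_odd' a <;> obtain ⟨b', hb' | hb'⟩ := Nat.even_or_odd' b <;>
    subst ha hb'
  · rw [← mul_add]
    simp only [lowWeightCount_double]
    have h1 := ih _ (by omega) e a' b' (by omega) rfl
    have h2 := ih _ (by omega) (e - 1) a' b' (by omega) rfl
    omega
  · rw [show 2 * a' + (2 * b' + 1) = 2 * (a' + b') + 1 by ring]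
    simp only [lowWeightCount_double, lowWeightCount_double_add_one]
    have h1 := ih _ (by omega) e a' (b' + 1) (by omega) rfl
    have h2 := ih _ (by omega) (e - 1) a' b' (by omega) rfl
    rw [← add_assoc] at h1
    omega
  · rw [show 2 * a' + 1 + 2 * b' = 2 * (a' + b') + 1 by ring]
    simp only [lowWeightCount_double, lowWeightCount_double_add_one]
    have h1 := ih _ (by omega) e (a' + 1) b' (by omega) rfl
    have h2 := ih _ (by omega) (e - 1) a' b' (by omega) rfl
    rw [show a' + 1 + b' = a' + b' + 1 by ring] at h1
    omega
  · rw [show 2 * a' + 1 + (2 * b' + 1) = 2 * (a' + b' + 1) by ring]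
    rw [lowWeightCount_double, lowWeightCount_double_add_one, lowWeightCount_double_add_one]
    -- For two odd arguments the halves are paired crosswise, which keeps the smaller one second.
    -- The discrepancy is harmless: weight below `e - 1` implies weight below `e`. For `a' = b'` the
    -- claim is the halving identity.
    rcases Nat.lt_or_ge b' a' with h | h
    · have h1 := ih _ (by omega) e a' (b' + 1) (by omega) rfl
      have h2 := ih _ (by omega) (e - 1) (a' + 1) b' (by omega) rfl
      rw [← add_assoc] at h1
      rw [show a' + 1 + b' = a' + b' + 1 by ring] at h2
      have h3 := lowWeightCount_succ e a'
      have h4 := lowWeightCount_succ (e - 1) a'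
      split_ifs at h3 h4 <;> omega
    · obtain rfl : a' = b' := by omega
      rw [← two_mul, lowWeightCount_double_add_one, lowWeightCount_double_add_one]
      try omega

theorem lowWeightCount_two_pow (e N : ℕ) :
    lowWeightCount e (2 ^ N) = ∑ k ∈ range e, N.choose k := by
  induction N generalizing e with
  | zero =>
    cases e with
    | zero => simp
    | succ e => rw [sum_range_succ']; simp [lowWeightCount_one]
  | succ N ih =>
    rw [pow_succ', lowWeightCount_double, ih, ih]
    cases e with
    | zero => simp
    | succ e =>
      rw [sum_range_succ' _ e, sum_range_succ' _ e]
      simp only [Nat.choose_succ_succ', sum_add_distrib, Nat.add_sub_cancel, Nat.choose_zero_right]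
      omega

/-! ### Dimension spanned by a subset of the cube -/

/-- The sign coded by a Boolean. -/
def boolSign (b : Bool) : ℝ := if b then 1 else -1

/-- The monomials of degree less than `e` at the sign vector coded by `b`, extended by zero. -/
def lowMonomials {n : ℕ} (e : ℕ) (b : Fin n → Bool) : Finset (Fin n) → ℝ :=
  fun I => if #I < e then ∏ i ∈ I, boolSign (b i) else 0

theorem lowMonomials_cons_map {n : ℕ} (e : ℕ) (ε : Bool) (b : Fin n → Bool) (I : Finset (Fin n)) :
    lowMonomials e (Fin.cons ε b : Fin (n + 1) → Bool) (I.map (Fin.succEmb n)) =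
      lowMonomials e b I := by
  simp [lowMonomials]

theorem lowMonomials_cons_insert {n : ℕ} (e : ℕ) (ε : Bool) (b : Fin n → Bool)
    (I : Finset (Fin n)) :
    lowMonomials e (Fin.cons ε b : Fin (n + 1) → Bool) (insert 0 (I.map (Fin.succEmb n))) =
      boolSign ε * lowMonomials (e - 1) b I := by
  have h : (0 : Fin (n + 1)) ∉ I.map (Fin.succEmb n) := by simp [Fin.succ_ne_zero]
  simp only [lowMonomials, card_insert_of_notMem h, prod_insert h, card_map, prod_map]
  by_cases hc : #I + 1 < e
  · simp [hc, show #I < e - 1 by omega]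
  · simp [hc, show ¬ #I < e - 1 by omega]

/-- Induction on `n`, splitting `S` by its first sign into `P` and `Q`. Forgetting the monomials
that contain the first variable maps the span onto a space containing the vectors of `P ∪ Q`. The
kernel sees `P ∩ Q` in degree one less. Rank–nullity and `lowWeightCount_add_le` combine the two
bounds. -/
theorem lowWeightCount_card_le_finrank {n : ℕ} (e : ℕ) (S : Finset (Fin n → Bool)) :
    lowWeightCount e #S ≤ finrank ℝ (Submodule.span ℝ (lowMonomials e '' (S : Set (Fin n → Bool)))) := by
  induction n generalizing e with
  | zero =>
    rcases Nat.eq_zero_or_pos e with rfl | he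
    · simp
    rcases S.eq_empty_or_nonempty with rfl | ⟨b, hb⟩
    · simp
    · have h1 : #S ≤ 1 := card_le_one.2 fun _ _ _ _ => Subsingleton.elim _ _
      refine (lowWeightCount_mono e h1).trans ?_
      have h2 : lowWeightCount e 1 = 1 := by
        obtain ⟨e, rfl⟩ := Nat.exists_eq_succ_of_ne_zero he.ne'
        exact lowWeightCount_one e
      rw [h2, Nat.one_le_iff_ne_zero, Ne, Submodule.finrank_eq_zero, Submodule.span_eq_bot]
      intro h
      have := congrFun (h _ (Set.mem_image_of_mem _ hb)) ∅
      simp [lowMonomials, he] at this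
  | succ n ih =>
    classical
    set P : Finset (Fin n → Bool) := univ.filter fun b => (Fin.cons true b : Fin (n + 1) → Bool) ∈ S
    set Q : Finset (Fin n → Bool) := univ.filter fun b => (Fin.cons false b : Fin (n + 1) → Bool) ∈ S
    have hcard : #S = #P + #Q := by
      have hP : #P = #(S.filter fun x => x 0 = true) := by
        refine card_bij (fun b _ => (Fin.cons true b : Fin (n + 1) → Bool)) ?_ ?_ ?_
        · intro b hb; simpa [P] using hb
        · intro b _ c _ h; exact (Fin.cons_inj.1 h).2
        · intro x hx
          rw [mem_filter] at hx
          refine ⟨Fin.tail x, ?_, ?_⟩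
          · simp [P, ← hx.2, Fin.cons_self_tail, hx.1]
          · rw [← hx.2, Fin.cons_self_tail]
      have hQ : #Q = #(S.filter fun x => ¬ x 0 = true) := by
        refine card_bij (fun b _ => (Fin.cons false b : Fin (n + 1) → Bool)) ?_ ?_ ?_
        · intro b hb; simpa [Q] using hb
        · intro b _ c _ h; exact (Fin.cons_inj.1 h).2
        · intro x hx
          rw [mem_filter, Bool.not_eq_true] at hx
          refine ⟨Fin.tail x, ?_, ?_⟩
          · simp [Q, ← hx.2, Fin.cons_self_tail, hx.1]
          · rw [← hx.2, Fin.cons_self_tail]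
      rw [hP, hQ, card_filter_add_card_filter_not]
    set V := Submodule.span ℝ (lowMonomials e '' (S : Set (Fin (n + 1) → Bool))) with hV
    let f : (Finset (Fin (n + 1)) → ℝ) →ₗ[ℝ] (Finset (Fin n) → ℝ) :=
      LinearMap.funLeft ℝ ℝ fun I => I.map (Fin.succEmb n)
    let g : (Finset (Fin (n + 1)) → ℝ) →ₗ[ℝ] (Finset (Fin n) → ℝ) :=
      LinearMap.funLeft ℝ ℝ fun I => insert 0 (I.map (Fin.succEmb n))
    have hf : ∀ ε b, f (lowMonomials e (Fin.cons ε b : Fin (n + 1) → Bool)) = lowMonomials e b :=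
      fun ε b => funext fun I => lowMonomials_cons_map e ε b I
    have hg : ∀ ε b, g (lowMonomials e (Fin.cons ε b : Fin (n + 1) → Bool)) =
        boolSign ε • lowMonomials (e - 1) b :=
      fun ε b => funext fun I => lowMonomials_cons_insert e ε b I
    have h1 : lowWeightCount e #(P ∪ Q) ≤ finrank ℝ (LinearMap.range (f.domRestrict V)) := by
      refine (ih e (P ∪ Q)).trans (Submodule.finrank_mono ?_)
      rw [Submodule.span_le]
      rintro _ ⟨b, hb, rfl⟩
      simp only [coe_union, Set.mem_union, mem_coe, P, Q, mem_filter, mem_univ, true_and] at hb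
      rcases hb with hb | hb
      · exact ⟨⟨_, Submodule.subset_span ⟨_, hb, rfl⟩⟩, hf _ _⟩
      · exact ⟨⟨_, Submodule.subset_span ⟨_, hb, rfl⟩⟩, hf _ _⟩
    have h2 : lowWeightCount (e - 1) #(P ∩ Q) ≤ finrank ℝ (LinearMap.ker (f.domRestrict V)) := by
      refine (ih (e - 1) (P ∩ Q)).trans ?_
      let h := g.comp (V.subtype.comp (LinearMap.ker (f.domRestrict V)).subtype)
      refine le_trans (Submodule.finrank_mono ?_) (LinearMap.finrank_range_le h)
      rw [Submodule.span_le]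
      rintro _ ⟨b, hb, rfl⟩
      simp only [coe_inter, Set.mem_inter_iff, mem_coe, P, Q, mem_filter, mem_univ, true_and] at hb
      -- Half the difference of the two lifts of `b` dies under `f`, and `g` sends it to the
      -- monomials of `b` of degree below `e - 1`.
      have hv : (2⁻¹ : ℝ) • (lowMonomials e (Fin.cons true b : Fin (n + 1) → Bool) -
          lowMonomials e (Fin.cons false b : Fin (n + 1) → Bool)) ∈ V :=
        V.smul_mem _ (V.sub_mem (Submodule.subset_span ⟨_, hb.1, rfl⟩)
          (Submodule.subset_span ⟨_, hb.2, rfl⟩))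
      refine ⟨⟨⟨_, hv⟩, ?_⟩, ?_⟩
      · simp [LinearMap.domRestrict_apply, hf]
      · change g ((2⁻¹ : ℝ) • (lowMonomials e (Fin.cons true b : Fin (n + 1) → Bool) -
          lowMonomials e (Fin.cons false b : Fin (n + 1) → Bool))) = _
        rw [map_smul, map_sub, hg, hg, ← sub_smul, smul_smul]
        norm_num [boolSign]
    have h3 := LinearMap.finrank_range_add_finrank_ker (f.domRestrict V)
    have h4 := card_union_add_card_inter P Q
    have h5 := lowWeightCount_add_le e #(P ∪ Q) #(P ∩ Q) (card_le_card (inter_subset_union))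
    rw [h4, ← hcard] at h5
    omega

/-- Extension by zero puts all degrees in one ambient space, as the induction on dimension needs. -/
theorem lowMonomials_eq_powLE {n : ℕ} (d : ℕ) :
    ∃ E : ({I : Finset (Fin n) // I.card ≤ d} → ℝ) →ₗ[ℝ] (Finset (Fin n) → ℝ),
      ∀ b : Fin n → Bool, E (powLE d (boolSign ∘ b)) = lowMonomials (d + 1) b := by
  refine ⟨LinearMap.pi fun I => if h : #I ≤ d then LinearMap.proj ⟨I, h⟩ else 0, fun b => ?_⟩
  funext I
  by_cases h : #I ≤ d
  · simp [h, lowMonomials, powLE, Nat.lt_succ_of_le h]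
  · simp [h, lowMonomials, show ¬ #I < d + 1 by omega]

/-- A subspace of small dimension contains few points `x^{≤ d}` with `x` in the cube. -/
theorem card_powLE_mem_lt {n : ℕ} (d N : ℕ)
    (V : Submodule ℝ ({I : Finset (Fin n) // I.card ≤ d} → ℝ))
    (hV : finrank ℝ V < binomSum N d) (S : Finset (Fin n → Bool))
    (hS : ∀ b ∈ S, powLE d (boolSign ∘ b) ∈ V) : #S < 2 ^ N := by
  by_contra! hc
  obtain ⟨E, hE⟩ := lowMonomials_eq_powLE (n := n) d
  have h1 := lowWeightCount_card_le_finrank (d + 1) S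
  have h2 : finrank ℝ (Submodule.span ℝ (lowMonomials (d + 1) '' (S : Set (Fin n → Bool)))) ≤
      finrank ℝ V := by
    refine le_trans (Submodule.finrank_mono ?_) (Submodule.finrank_map_le E V)
    rw [Submodule.span_le]
    rintro _ ⟨b, hb, rfl⟩
    exact ⟨_, hS b hb, hE b⟩
  have h3 := lowWeightCount_mono (d + 1) hc
  rw [lowWeightCount_two_pow] at h3
  exact absurd (h3.trans (h1.trans h2)) (not_le.2 hV)

/-! ### Resampling and dependence of random powers -/

/-- Double counting: if `A` is fibred by overriding the `G`-part of its elements and `R` holds for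
at most `K` elements of every fibre, then the density of `R` is at most `K / |G|`. -/
theorem card_filter_mul_card_le_of_override {A G : Type*} [Fintype A] [Fintype G]
    (ov : A → G → A) (rs : A → G) (h1 : ∀ f g, ov (ov f g) (rs f) = f)
    (h2 : ∀ f g, rs (ov f g) = g) (R : A → Prop) [DecidablePred R] (K : ℕ)
    (hK : ∀ f, #{g | R (ov f g)} ≤ K) : #{f | R f} * Fintype.card G ≤ Fintype.card A * K := by
  calc #{f | R f} * Fintype.card G = #((univ.filter R) ×ˢ (univ : Finset G)) := by
        rw [card_product, card_univ]
    _ ≤ #((univ : Finset A).sigma fun f => univ.filter fun g => R (ov f g)) := by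
        -- Exchanging `g` with the `G`-part of `f` loses nothing, and overriding again recovers `f`.
        refine card_le_card_of_injOn (fun p => ⟨ov p.1 p.2, rs p.1⟩) ?_ ?_
        · rintro ⟨f, g⟩ h
          simpa [h1] using h
        · rintro ⟨f, g⟩ _ ⟨f', g'⟩ _ h
          simp only [Sigma.mk.injEq, heq_eq_eq] at h
          have hf : f = f' := by rw [← h1 f g, ← h1 f' g', h.1, h.2]
          have hg : g = g' := by rw [← h2 f g, ← h2 f' g', h.1]
          rw [hf, hg]
    _ ≤ Fintype.card A * K := by
        rw [card_sigma, ← smul_eq_mul, ← card_univ]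
        exact sum_le_card_nsmul _ _ _ fun f _ => hK f

theorem card_filter_mul_card_le_of_update {ι β : Type*} [Fintype ι] [DecidableEq ι] [Fintype β]
    (R : (ι → β) → Prop) [DecidablePred R] (i : ι) (K : ℕ)
    (hK : ∀ f, #{b | R (Function.update f i b)} ≤ K) :
    #{f | R f} * Fintype.card β ≤ Fintype.card (ι → β) * K :=
  card_filter_mul_card_le_of_override (fun f b => Function.update f i b) (fun f => f i)
    (by simp) (by simp) R K hK

open Classical in
/-- Few families of points of the cube have linearly dependent `d`-th powers. -/
theorem card_not_linearIndepOn_powLE_le {m a : ℕ} (d N : ℕ) (J : Finset (Fin m))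
    (hJ : #J ≤ binomSum N d) :
    #{X : Fin m → Fin a → Bool |
        ¬ LinearIndepOn ℝ (fun i => powLE d (boolSign ∘ X i)) (J : Set (Fin m))} * 2 ^ a ≤
      Fintype.card (Fin m → Fin a → Bool) * (#J * 2 ^ N) := by
  set R : Fin m → (Fin m → Fin a → Bool) → Prop := fun i X =>
    powLE d (boolSign ∘ X i) ∈ Submodule.span ℝ
      ((fun j => powLE d (boolSign ∘ X j)) '' ((J.erase i : Finset (Fin m)) : Set (Fin m))) with hR
  have hsub : univ.filter (fun X : Fin m → Fin a → Bool =>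
        ¬ LinearIndepOn ℝ (fun i => powLE d (boolSign ∘ X i)) (J : Set (Fin m))) ⊆
      J.biUnion fun i => univ.filter (R i) := by
    intro X hX
    simp only [mem_filter, mem_univ, true_and, linearIndepOn_iff_notMem_span, not_forall,
      not_not] at hX
    obtain ⟨i, hi, h⟩ := hX
    simp only [mem_biUnion, mem_filter, mem_univ, true_and]
    refine ⟨i, hi, ?_⟩
    simpa [hR] using h
  have hone : ∀ i ∈ J, #(univ.filter (R i)) * 2 ^ a ≤
      Fintype.card (Fin m → Fin a → Bool) * 2 ^ N := by
    intro i hi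
    -- With the other vectors fixed, their span has dimension below `#J`, so fewer than `2 ^ N`
    -- values of the `i`-th vector fall in it.
    have := card_filter_mul_card_le_of_update (R i) i (2 ^ N) ?_
    · simpa using this
    intro X
    refine (card_powLE_mem_lt d N (Submodule.span ℝ
      ((fun j => powLE d (boolSign ∘ X j)) '' ((J.erase i : Finset (Fin m)) : Set (Fin m))))
      ?_ _ ?_).le
    · refine lt_of_lt_of_le ?_ hJ
      rw [← coe_image]
      refine (finrank_span_finset_le_card _).trans_lt (card_image_le.trans_lt ?_)
      exact card_erase_lt_of_mem hi
    · intro b hb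
      simp only [hR, mem_filter, mem_univ, true_and, Function.update_self] at hb
      convert hb using 2
      refine Set.image_congr fun j hj => ?_
      rw [Function.update_of_ne (by simpa using (mem_erase.1 (mem_coe.1 hj)).1)]
  calc _ ≤ (∑ i ∈ J, #(univ.filter (R i))) * 2 ^ a :=
        Nat.mul_le_mul_right _ ((card_le_card hsub).trans card_biUnion_le)
    _ ≤ ∑ i ∈ J, Fintype.card (Fin m → Fin a → Bool) * 2 ^ N := by
        rw [sum_mul]; exact sum_le_sum hone
    _ = _ := by rw [sum_const, smul_eq_mul]; ring

/-! ### Littlewood–Offord bounds -/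

@[simp] theorem boolSign_true : boolSign true = 1 := rfl
@[simp] theorem boolSign_false : boolSign false = -1 := rfl

theorem boolSign_injective : Function.Injective boolSign := by
  intro a b h
  cases a <;> cases b <;> simp_all [boolSign] <;> norm_num at h

theorem boolSign_eq_or (b : Bool) : boolSign b = 1 ∨ boolSign b = -1 := by
  cases b <;> simp

open Classical in
/-- The Littlewood–Offord inequality for signed sums, with nonzero coefficients on `S`. -/
theorem card_signed_sum_eq_mul_le {κ : Type*} [Fintype κ] [DecidableEq κ] (c : κ → ℝ)
    (S : Finset κ) (hS : ∀ i ∈ S, c i ≠ 0) (v : ℝ) :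
    #{ε : κ → Bool | ∑ i, c i * boolSign (ε i) = v} * 2 ^ #S ≤
      Fintype.card (κ → Bool) * (#S).choose (#S / 2) := by
  have key := card_filter_mul_card_le_of_override (A := κ → Bool) (G := S → Bool)
    (fun f g i => if h : i ∈ S then g ⟨i, h⟩ else f i) (fun f i => f i)
    (fun f g => by funext i; by_cases h : i ∈ S <;> simp [h])
    (fun f g => by funext i; simp)
    (fun ε => ∑ i, c i * boolSign (ε i) = v) ((#S).choose (#S / 2)) ?_
  · simpa using key
  intro f
  -- Once the signs off `S` are fixed, a pattern is coded by its set of positive terms. Enlarging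
  -- this set strictly raises the sum, so the solutions form an antichain and Sperner's theorem
  -- applies.
  let T : (S → Bool) → Finset S := fun g => univ.filter fun i => 0 < c i * boolSign (g i)
  have hsum : ∀ g : S → Bool,
      ∑ i, c i * boolSign (if h : i ∈ S then g ⟨i, h⟩ else f i) =
        ∑ i : S, c i * boolSign (g i) + ∑ i ∈ Sᶜ, c i * boolSign (f i) := by
    intro g
    rw [← sum_add_sum_compl S]
    congr 1
    · rw [← sum_coe_sort S]
      exact sum_congr rfl fun i _ => by simp
    · exact sum_congr rfl fun i hi => by simp [mem_compl.1 hi]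
  have hval : ∀ (g : S → Bool) (i : S), c i * boolSign (g i) = if i ∈ T g then |c i| else -|c i| := by
    intro g i
    have h0 := hS i i.2
    simp only [T, mem_filter, mem_univ, true_and]
    rcases boolSign_eq_or (g i) with h | h <;> rcases lt_or_gt_of_ne h0 with h' | h' <;>
      simp [h, h', h'.not_gt, abs_of_neg, abs_of_pos]
  have hTinj : Function.Injective T := by
    intro g g' h
    funext i
    have h0 := hS i i.2
    apply boolSign_injective
    apply mul_left_cancel₀ h0
    rw [hval, hval, h]
  have hanti : IsAntichain (· ⊆ ·) (((univ.filter fun g : S → Bool =>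
      ∑ i, c i * boolSign (if h : i ∈ S then g ⟨i, h⟩ else f i) = v).image T :
        Finset (Finset S)) : Set (Finset S)) := by
    intro A hA B hB hne hAB
    simp only [coe_image, Set.mem_image, mem_coe, mem_filter, mem_univ, true_and] at hA hB
    obtain ⟨g, hg, rfl⟩ := hA
    obtain ⟨g', hg', rfl⟩ := hB
    rw [hsum] at hg hg'
    have hlt : ∑ i : S, c i * boolSign (g i) < ∑ i : S, c i * boolSign (g' i) := by
      simp only [hval]
      obtain ⟨j, hj, hj'⟩ := exists_of_ssubset (hAB.ssubset_of_ne hne)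
      refine sum_lt_sum (fun i _ => ?_) ⟨j, mem_univ _, ?_⟩
      · by_cases h : i ∈ T g
        · simp [h, hAB h]
        · have := abs_nonneg (c i)
          simp only [h, if_false]
          split_ifs <;> linarith
      · simp only [hj, hj', if_true, if_false]
        have := abs_pos.2 (hS j j.2)
        linarith
    linarith
  have := hanti.sperner
  rw [card_image_of_injective _ hTinj, Fintype.card_coe] at this
  exact this

theorem sum_mul_boolSign_update {κ : Type*} [Fintype κ] [DecidableEq κ] (c : κ → ℝ)
    (f : κ → Bool) (i : κ) (b : Bool) :
    ∑ k, c k * boolSign (Function.update f i b k) =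
      ∑ k, c k * boolSign (f k) + c i * (boolSign b - boolSign (f i)) := by
  rw [← sub_eq_iff_eq_add', ← sum_sub_distrib, sum_eq_single i]
  · simp [mul_sub]
  · intro k _ hk
    simp [Function.update_of_ne hk]
  · simp

open Classical in
-- Fix all signs but two. If all four patterns gave `±1`, both coefficients would be `±1`, and the
-- sums would spread over a range of length `4`.
theorem card_signed_sum_eq_one_or_mul_le {κ : Type*} [Fintype κ] [DecidableEq κ] (c : κ → ℝ) (i j : κ)
    (hij : i ≠ j) (hi : c i ≠ 0) (hj : c j ≠ 0) :
    #{ε : κ → Bool | ∑ k, c k * boolSign (ε k) = 1 ∨ ∑ k, c k * boolSign (ε k) = -1} * 4 ≤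
      Fintype.card (κ → Bool) * 3 := by
  have key := card_filter_mul_card_le_of_override (A := κ → Bool) (G := Bool × Bool)
    (fun f g => Function.update (Function.update f i g.1) j g.2) (fun f => (f i, f j))
    (fun f g => by
      funext k
      by_cases hk : k = j
      · subst hk; simp
      · by_cases hk' : k = i
        · subst hk'; simp [hk]
        · simp [hk, hk'])
    (fun f g => by simp [hij])
    (fun ε => ∑ k, c k * boolSign (ε k) = 1 ∨ ∑ k, c k * boolSign (ε k) = -1) 3 ?_
  · simpa using key
  intro f
  by_contra! hc
  have huniv : univ.filter (fun g : Bool × Bool =>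
      ∑ k, c k * boolSign (Function.update (Function.update f i g.1) j g.2 k) = 1 ∨
      ∑ k, c k * boolSign (Function.update (Function.update f i g.1) j g.2 k) = -1) = univ := by
    rw [← card_eq_iff_eq_univ]
    have := card_filter_le (univ : Finset (Bool × Bool)) (fun g : Bool × Bool =>
      ∑ k, c k * boolSign (Function.update (Function.update f i g.1) j g.2 k) = 1 ∨
      ∑ k, c k * boolSign (Function.update (Function.update f i g.1) j g.2 k) = -1)
    simp only [card_univ, Fintype.card_prod, Fintype.card_bool] at this ⊢
    omega
  have hall : ∀ b b', ∑ k, c k * boolSign (Function.update (Function.update f i b) j b' k) = 1 ∨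
      ∑ k, c k * boolSign (Function.update (Function.update f i b) j b' k) = -1 := by
    intro b b'
    have := mem_univ (b, b')
    rw [← huniv, mem_filter] at this
    exact this.2
  simp only [sum_mul_boolSign_update, Function.update_of_ne hij.symm] at hall
  have h1 := hall true true
  have h2 := hall true false
  have h3 := hall false true
  have h4 := hall false false
  simp only [boolSign_true, boolSign_false] at h1 h2 h3 h4
  generalize ∑ k, c k * boolSign (f k) = r at *
  generalize boolSign (f i) = x at *
  generalize boolSign (f j) = y at *
  have e1 : c i = 0 ∨ c i = 1 ∨ c i = -1 := by
    rcases h1 with h1 | h1 <;> rcases h3 with h3 | h3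
    · left; linarith
    · right; left; linarith
    · right; right; linarith
    · left; linarith
  have e2 : c j = 0 ∨ c j = 1 ∨ c j = -1 := by
    rcases h1 with h1 | h1 <;> rcases h2 with h2 | h2
    · left; linarith
    · right; left; linarith
    · right; right; linarith
    · left; linarith
  rcases e1 with e1 | e1 | e1
  · exact hi e1
  all_goals
    rcases e2 with e2 | e2 | e2
    · exact hj e2
    all_goals
      rcases h1 with h1 | h1 <;> rcases h2 with h2 | h2 <;> rcases h3 with h3 | h3 <;>
        rcases h4 with h4 | h4 <;> rw [e1, e2] at h1 h2 h3 h4 <;> linarith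

/-- The factor `2 * h + 1` closes the induction, since `(2h+1)(2h+3) ≤ 4(h+1)²`. -/
theorem centralBinom_sq_mul_le (h : ℕ) : h.centralBinom ^ 2 * (2 * h + 1) ≤ 16 ^ h := by
  induction h with
  | zero => simp
  | succ h ih =>
    have e := Nat.succ_mul_centralBinom_succ h
    have hpos : 0 < (h + 1) ^ 2 := by positivity
    refine Nat.le_of_mul_le_mul_left ?_ hpos
    calc (h + 1) ^ 2 * ((h + 1).centralBinom ^ 2 * (2 * (h + 1) + 1))
        = ((h + 1) * (h + 1).centralBinom) ^ 2 * (2 * h + 3) := by ring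
      _ = (h.centralBinom ^ 2 * (2 * h + 1)) * (4 * (2 * h + 1) * (2 * h + 3)) := by
          rw [e]; ring
      _ ≤ 16 ^ h * (16 * (h + 1) ^ 2) := Nat.mul_le_mul ih (by nlinarith)
      _ = (h + 1) ^ 2 * 16 ^ (h + 1) := by ring

theorem choose_half_sq_mul_le (s : ℕ) : (s.choose (s / 2)) ^ 2 * s ≤ 4 ^ s := by
  obtain ⟨h, rfl | rfl⟩ := Nat.even_or_odd' s
  · have := centralBinom_sq_mul_le h
    rw [Nat.centralBinom] at this
    rw [show 2 * h / 2 = h by omega, pow_mul]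
    norm_num
    nlinarith [sq_nonneg ((2 * h).choose h)]
  · have := centralBinom_sq_mul_le (h + 1)
    have e : (h + 1).centralBinom = 2 * (2 * h + 1).choose h := by
      rw [Nat.centralBinom, show 2 * (h + 1) = 2 * h + 1 + 1 by ring, Nat.choose_succ_succ',
        Nat.choose_symm_half]
      ring
    rw [e] at this
    rw [show (2 * h + 1) / 2 = h by omega]
    have e2 : (4 : ℕ) ^ (2 * h + 1) = 4 * 16 ^ h := by
      rw [pow_succ, pow_mul]; norm_num; ring
    rw [e2]
    have e3 : (16 : ℕ) ^ (h + 1) = 16 * 16 ^ h := by ring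
    rw [e3] at this
    nlinarith [Nat.zero_le (((2 * h + 1).choose h) ^ 2)]

open Classical in
theorem card_signed_sum_eq_one_or_le_sqrt {m : ℕ} (c : Fin m → ℝ) (s : ℕ) (hs : 0 < s)
    (hc : s ≤ #{i | c i ≠ 0}) :
    (#{ε : Fin m → Bool | ∑ k, c k * boolSign (ε k) = 1 ∨ ∑ k, c k * boolSign (ε k) = -1} : ℝ) ≤
      2 / √s * 2 ^ m := by
  obtain ⟨S, hSsub, hScard⟩ := exists_subset_card_eq hc
  have hS : ∀ i ∈ S, c i ≠ 0 := fun i hi => (mem_filter.1 (hSsub hi)).2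
  have hone : ∀ v : ℝ,
      (#{ε : Fin m → Bool | ∑ k, c k * boolSign (ε k) = v} : ℝ) ≤ 1 / √s * 2 ^ m := by
    intro v
    have h := card_signed_sum_eq_mul_le c S hS v
    rw [hScard] at h
    have h' : (#{ε : Fin m → Bool | ∑ k, c k * boolSign (ε k) = v} : ℝ) * 2 ^ s ≤
        2 ^ m * (s.choose (s / 2) : ℝ) := by
      simp only [Fintype.card_pi, Fintype.card_bool, prod_const, card_univ, Fintype.card_fin] at h
      exact_mod_cast h
    have hsr : (0 : ℝ) < √s := Real.sqrt_pos.2 (by exact_mod_cast hs)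
    have hch : (s.choose (s / 2) : ℝ) * √s ≤ 2 ^ s := by
      refine (pow_le_pow_iff_left₀ (by positivity) (by positivity) two_ne_zero).1 ?_
      rw [mul_pow, Real.sq_sqrt (by positivity), ← pow_mul, mul_comm s 2, pow_mul,
        show (2 : ℝ) ^ 2 = 4 by norm_num]
      exact_mod_cast choose_half_sq_mul_le s
    rw [div_mul_eq_mul_div, one_mul, le_div_iff₀ hsr]
    have h2 : (0 : ℝ) < 2 ^ s := by positivity
    refine le_of_mul_le_mul_right ?_ h2
    calc _ = ((#{ε : Fin m → Bool | ∑ k, c k * boolSign (ε k) = v} : ℝ) * 2 ^ s) * √s := by ring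
      _ ≤ (2 ^ m * (s.choose (s / 2) : ℝ)) * √s := by gcongr
      _ = 2 ^ m * ((s.choose (s / 2) : ℝ) * √s) := by ring
      _ ≤ 2 ^ m * 2 ^ s := by gcongr
  rw [filter_or]
  refine (Nat.cast_le.2 (card_union_le _ _)).trans ?_
  push_cast
  calc _ ≤ 1 / √(s : ℝ) * 2 ^ m + 1 / √(s : ℝ) * 2 ^ m := add_le_add (hone 1) (hone (-1))
    _ = _ := by ring

open Classical in
theorem card_signed_sum_eq_one_or_le_three_quarters {m : ℕ} (c : Fin m → ℝ)
    (hc : 2 ≤ #{i | c i ≠ 0}) :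
    (#{ε : Fin m → Bool | ∑ k, c k * boolSign (ε k) = 1 ∨ ∑ k, c k * boolSign (ε k) = -1} : ℝ) ≤
      3 / 4 * 2 ^ m := by
  obtain ⟨i, hi, j, hj, hij⟩ := one_lt_card.1 hc
  have h := card_signed_sum_eq_one_or_mul_le c i j hij (mem_filter.1 hi).2 (mem_filter.1 hj).2
  have h' : (#{ε : Fin m → Bool | ∑ k, c k * boolSign (ε k) = 1 ∨
      ∑ k, c k * boolSign (ε k) = -1} : ℝ) * 4 ≤ 2 ^ m * 3 := by
    simp only [Fintype.card_pi, Fintype.card_bool, prod_const, card_univ, Fintype.card_fin] at h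
    exact_mod_cast h
  linarith

/-! ### Combinations of powers that lie in the cube -/

/-- The `d`-th power of some vector of the cube is a combination of the `d`-th powers of the
vectors coded by `X`, with coefficients supported on `J` and at least `s` of them nonzero. -/
def HasCombination {m n : ℕ} (d : ℕ) (J : Finset (Fin m)) (s : ℕ) (X : Fin m → Fin n → Bool) :
    Prop :=
  ∃ c : Fin m → ℝ, (∀ i ∉ J, c i = 0) ∧ s ≤ #{i | c i ≠ 0} ∧ ∃ u : Fin n → Bool,
    powLE d (boolSign ∘ u) = ∑ i, c i • powLE d (boolSign ∘ X i)

theorem powLE_eq_sum_castAdd {m a q d : ℕ} {X : Fin m → Fin (a + q) → Bool} {c : Fin m → ℝ}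
    {u : Fin (a + q) → Bool}
    (h : powLE d (boolSign ∘ u) = ∑ i, c i • powLE d (boolSign ∘ X i)) :
    powLE d (boolSign ∘ fun r => u (Fin.castAdd q r)) =
      ∑ i, c i • powLE d (boolSign ∘ fun r => X i (Fin.castAdd q r)) := by
  funext I
  have := congrFun h ⟨I.1.map (Fin.castAddEmb q), by simpa using I.2⟩
  simpa [powLE, prod_map] using this

theorem boolSign_eq_sum_of_powLE_eq {m n d : ℕ} (hd : 0 < d) {X : Fin m → Fin n → Bool}
    {c : Fin m → ℝ} {u : Fin n → Bool}
    (h : powLE d (boolSign ∘ u) = ∑ i, c i • powLE d (boolSign ∘ X i)) (r : Fin n) :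
    boolSign (u r) = ∑ i, c i * boolSign (X i r) := by
  have := congrFun h ⟨{r}, by rw [card_singleton]; exact hd⟩
  simpa [powLE] using this

theorem LinearIndepOn.eq_of_sum_smul_eq {m : ℕ} {V : Type*} [AddCommGroup V] [Module ℝ V]
    {J : Finset (Fin m)} {v : Fin m → V} (h : LinearIndepOn ℝ v (J : Set (Fin m)))
    {c c' : Fin m → ℝ} (hc : ∀ i ∉ J, c i = 0) (hc' : ∀ i ∉ J, c' i = 0)
    (heq : ∑ i, c i • v i = ∑ i, c' i • v i) : c = c' := by
  rw [linearIndepOn_finset_iff] at h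
  have h0 : ∑ i ∈ J, (c i - c' i) • v i = 0 := by
    rw [sum_subset (subset_univ J) fun i _ hi => by simp [hc i hi, hc' i hi]]
    simp only [sub_smul, sum_sub_distrib, heq, sub_self]
  funext i
  by_cases hi : i ∈ J
  · exact sub_eq_zero.1 (h _ h0 i hi)
  · rw [hc i hi, hc' i hi]

open Classical in
/-- If the restrictions of the vectors to the first `a` coordinates are independent, the remaining
`q` coordinates admit few values for which some combination lies in the cube. -/
theorem card_tail_le {m a q d : ℕ} (J : Finset (Fin m)) (s : ℕ) (Y : Fin m → Fin a → Bool)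
    (hY : LinearIndepOn ℝ (fun i => powLE d (boolSign ∘ Y i)) (J : Set (Fin m))) (K : ℕ)
    (hK : ∀ c : Fin m → ℝ, s ≤ #{i | c i ≠ 0} → #{ε : Fin m → Bool |
      ∑ k, c k * boolSign (ε k) = 1 ∨ ∑ k, c k * boolSign (ε k) = -1} ≤ K) :
    #{Z : Fin q → Fin m → Bool | ∃ c : Fin m → ℝ, (∀ i ∉ J, c i = 0) ∧ s ≤ #{i | c i ≠ 0} ∧
      (∃ y : Fin a → Bool, powLE d (boolSign ∘ y) = ∑ i, c i • powLE d (boolSign ∘ Y i)) ∧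
      ∀ r, ∑ i, c i * boolSign (Z r i) = 1 ∨ ∑ i, c i * boolSign (Z r i) = -1} ≤
    2 ^ a * K ^ q := by
  let F : (Fin a → Bool) → Finset (Fin q → Fin m → Bool) := fun y => univ.filter fun Z =>
    ∃ c : Fin m → ℝ, (∀ i ∉ J, c i = 0) ∧ s ≤ #{i | c i ≠ 0} ∧
      powLE d (boolSign ∘ y) = ∑ i, c i • powLE d (boolSign ∘ Y i) ∧
      ∀ r, ∑ i, c i * boolSign (Z r i) = 1 ∨ ∑ i, c i * boolSign (Z r i) = -1
  have hF : ∀ y, #(F y) ≤ K ^ q := by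
    intro y
    rcases (F y).eq_empty_or_nonempty with h | ⟨Z₀, hZ₀⟩
    · simp [h]
    obtain ⟨c, hcJ, hcs, hcy, -⟩ := (mem_filter.1 hZ₀).2
    have hsub : F y ⊆ Fintype.piFinset fun _ : Fin q => univ.filter fun ε : Fin m → Bool =>
        ∑ k, c k * boolSign (ε k) = 1 ∨ ∑ k, c k * boolSign (ε k) = -1 := by
      intro Z hZ
      obtain ⟨c', hcJ', -, hcy', hr⟩ := (mem_filter.1 hZ).2
      -- Independence lets `y` alone determine the coefficients, so the `q` tail conditions are
      -- separate conditions with the same `c`.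
      obtain rfl : c = c' := hY.eq_of_sum_smul_eq hcJ hcJ' (hcy.symm.trans hcy')
      simpa [Fintype.mem_piFinset] using hr
    refine (card_le_card hsub).trans ?_
    rw [Fintype.card_piFinset_const]
    exact Nat.pow_le_pow_left (hK c hcs) q
  refine (card_le_card (t := univ.biUnion F) ?_).trans ?_
  · intro Z hZ
    obtain ⟨c, h1, h2, ⟨y, h3⟩, h4⟩ := (mem_filter.1 hZ).2
    exact mem_biUnion.2 ⟨y, mem_univ _, mem_filter.2 ⟨mem_univ _, c, h1, h2, h3, h4⟩⟩
  · refine (card_biUnion_le_card_mul _ _ _ fun y _ => hF y).trans ?_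
    simp

open Classical in
-- Cut each vector after `a` coordinates. Dependent heads are counted with arbitrary tails;
-- independent heads leave only the tails of `card_tail_le`, because the singleton monomials force
-- signed sums `±1`.
theorem card_hasCombination_le_add {m a q d : ℕ} (hd : 0 < d) (J : Finset (Fin m)) (s K : ℕ)
    (hK : ∀ c : Fin m → ℝ, s ≤ #{i | c i ≠ 0} → #{ε : Fin m → Bool |
      ∑ k, c k * boolSign (ε k) = 1 ∨ ∑ k, c k * boolSign (ε k) = -1} ≤ K) :
    #{X : Fin m → Fin (a + q) → Bool | HasCombination d J s X} ≤
      #{Y : Fin m → Fin a → Bool |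
        ¬ LinearIndepOn ℝ (fun i => powLE d (boolSign ∘ Y i)) (J : Set (Fin m))} * 2 ^ (m * q) +
      2 ^ (m * a) * (2 ^ a * K ^ q) := by
  set D : Finset (Fin m → Fin a → Bool) := univ.filter fun Y =>
    ¬ LinearIndepOn ℝ (fun i => powLE d (boolSign ∘ Y i)) (J : Set (Fin m)) with hD
  let G : (Fin m → Fin a → Bool) → Finset (Fin q → Fin m → Bool) := fun Y => univ.filter fun Z =>
    ∃ c : Fin m → ℝ, (∀ i ∉ J, c i = 0) ∧ s ≤ #{i | c i ≠ 0} ∧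
      (∃ y : Fin a → Bool, powLE d (boolSign ∘ y) = ∑ i, c i • powLE d (boolSign ∘ Y i)) ∧
      ∀ r, ∑ i, c i * boolSign (Z r i) = 1 ∨ ∑ i, c i * boolSign (Z r i) = -1
  let Φ : (Fin m → Fin (a + q) → Bool) → Σ _ : Fin m → Fin a → Bool, (Fin q → Fin m → Bool) :=
    fun X => ⟨fun i r => X i (Fin.castAdd q r), fun r i => X i (Fin.natAdd a r)⟩
  have hΦ : Function.Injective Φ := by
    intro X X' h
    simp only [Φ, Sigma.mk.injEq, heq_eq_eq] at h
    funext i r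
    induction r using Fin.addCases with
    | left r => exact congrFun (congrFun h.1 i) r
    | right r => exact congrFun (congrFun h.2 r) i
  calc _ ≤ #((D.sigma fun _ => univ) ∪ (Dᶜ.sigma G)) := by
        refine card_le_card_of_injOn Φ ?_ hΦ.injOn
        intro X hX
        obtain ⟨c, h1, h2, u, h3⟩ := (mem_filter.1 (mem_coe.1 hX)).2
        rw [mem_coe, mem_union, mem_sigma, mem_sigma]
        by_cases hXD : (Φ X).1 ∈ D
        · exact Or.inl ⟨hXD, mem_univ _⟩
        · refine Or.inr ⟨mem_compl.2 hXD, mem_filter.2 ⟨mem_univ _, c, h1, h2,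
            ⟨_, powLE_eq_sum_castAdd h3⟩, fun r => ?_⟩⟩
          change ∑ i, c i * boolSign (X i (Fin.natAdd a r)) = 1 ∨
            ∑ i, c i * boolSign (X i (Fin.natAdd a r)) = -1
          rw [← boolSign_eq_sum_of_powLE_eq hd h3]
          exact boolSign_eq_or _
    _ ≤ #(D.sigma fun _ => (univ : Finset (Fin q → Fin m → Bool))) + #(Dᶜ.sigma G) :=
        card_union_le _ _
    _ ≤ _ := by
        refine add_le_add (le_of_eq ?_) ?_
        · rw [card_sigma]
          simp [pow_mul]
        · rw [card_sigma]
          refine (sum_le_card_nsmul _ _ (2 ^ a * K ^ q) fun Y hY => ?_).trans ?_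
          · refine card_tail_le J s Y ?_ K hK
            simpa [hD] using hY
          · rw [smul_eq_mul]
            refine Nat.mul_le_mul_right _ ((card_le_univ _).trans_eq ?_)
            simp [pow_mul, mul_comm m a]

open Classical in
/-- The density of the families that admit a combination with at least `s` nonzero coefficients. -/
theorem card_hasCombination_le {m a q d : ℕ} (hd : 0 < d) (J : Finset (Fin m)) (s N : ℕ)
    (hJ : #J ≤ binomSum N d) (κ : ℝ) (hκ0 : 0 ≤ κ)
    (hκ : ∀ c : Fin m → ℝ, s ≤ #{i | c i ≠ 0} → (#{ε : Fin m → Bool |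
      ∑ k, c k * boolSign (ε k) = 1 ∨ ∑ k, c k * boolSign (ε k) = -1} : ℝ) ≤ κ * 2 ^ m) :
    (#{X : Fin m → Fin (a + q) → Bool | HasCombination d J s X} : ℝ) ≤
      2 ^ (m * (a + q)) * (#J * 2 ^ N / 2 ^ a + 2 ^ a * κ ^ q) := by
  have h1 := card_hasCombination_le_add (a := a) (q := q) hd J s ⌊κ * 2 ^ m⌋₊
    fun c hc => Nat.le_floor (hκ c hc)
  have h2 := card_not_linearIndepOn_powLE_le (a := a) d N J hJ
  set D := #{Y : Fin m → Fin a → Bool |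
        ¬ LinearIndepOn ℝ (fun i => powLE d (boolSign ∘ Y i)) (J : Set (Fin m))}
  have h2' : (D : ℝ) ≤ 2 ^ (m * a) * (#J * 2 ^ N / 2 ^ a) := by
    rw [← mul_div_assoc, le_div_iff₀ (by positivity)]
    have : Fintype.card (Fin m → Fin a → Bool) = 2 ^ (m * a) := by simp [pow_mul, mul_comm m a]
    rw [this] at h2
    exact_mod_cast h2
  have h1' : (#{X : Fin m → Fin (a + q) → Bool | HasCombination d J s X} : ℝ) ≤
      D * 2 ^ (m * q) + 2 ^ (m * a) * (2 ^ a * (⌊κ * 2 ^ m⌋₊ : ℝ) ^ q) := by exact_mod_cast h1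
  calc _ ≤ _ := h1'
    _ ≤ (2 ^ (m * a) * (#J * 2 ^ N / 2 ^ a)) * 2 ^ (m * q) +
        2 ^ (m * a) * (2 ^ a * (κ * 2 ^ m) ^ q) := by
        gcongr
        exact Nat.floor_le (by positivity)
    _ = _ := by rw [mul_pow, ← pow_mul, mul_add m, pow_add]; ring

/-! ### Extra powers and the union bound -/

/-- The span of the `d`-th powers of the vectors coded by `X` contains the `d`-th power of a vector
of the cube other than these powers and their negatives. -/
def HasExtraPower {m n : ℕ} (d : ℕ) (X : Fin m → Fin n → Bool) : Prop :=
  ∃ u : Fin n → Bool,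
    powLE d (boolSign ∘ u) ∈ Submodule.span ℝ (Set.range fun k => powLE d (boolSign ∘ X k)) ∧
    ∀ k, powLE d (boolSign ∘ u) ≠ powLE d (boolSign ∘ X k) ∧
      powLE d (boolSign ∘ u) ≠ -powLE d (boolSign ∘ X k)

theorem Finset.exists_image_univ_eq {α : Type*} [DecidableEq α] {S : Finset α} {s : ℕ}
    (hS : S.Nonempty) (h : #S ≤ s) : ∃ f : Fin s → α, univ.image f = S := by
  obtain ⟨x, hx⟩ := hS
  refine ⟨fun i => if hi : i.1 < #S then S.equivFin.symm ⟨i, hi⟩ else x, ?_⟩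
  ext y
  simp only [mem_image, mem_univ, true_and]
  constructor
  · rintro ⟨i, rfl⟩
    split_ifs
    · exact Subtype.coe_prop _
    · exact hx
  · intro hy
    refine ⟨⟨S.equivFin ⟨y, hy⟩, (Fin.is_lt _).trans_le h⟩, ?_⟩
    simp

open Classical in
-- The empty monomial makes the coefficients sum to `1`. Hence some are nonzero, and a single one
-- would be `1` and reproduce a given power. A support of size at most `s` is the image of a
-- function on `Fin s`, repetitions allowed.
theorem HasExtraPower.hasCombination {m n d : ℕ} {X : Fin m → Fin n → Bool}
    (h : HasExtraPower d X) (s : ℕ) : HasCombination d univ s X ∨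
      ∃ f : Fin s → Fin m, HasCombination d (univ.image f) 2 X := by
  obtain ⟨u, hu, hne⟩ := h
  obtain ⟨c, hc⟩ := (Submodule.mem_span_range_iff_exists_fun ℝ).1 hu
  by_cases hs : s ≤ #{i | c i ≠ 0}
  · exact Or.inl ⟨c, by simp, hs, u, hc.symm⟩
  right
  have hempty : ∑ i, c i = 1 := by
    simpa [powLE] using congrFun hc ⟨∅, by simp⟩
  have h0 : (univ.filter fun i => c i ≠ 0).Nonempty := by
    rw [nonempty_iff_ne_empty]
    intro h
    rw [filter_eq_empty_iff] at h
    have : ∑ i, c i = 0 := sum_eq_zero fun i hi => not_not.1 (h hi)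
    linarith
  have h2 : 2 ≤ #{i | c i ≠ 0} := by
    by_contra h
    obtain ⟨k, hk⟩ := card_eq_one.1 (show #{i | c i ≠ 0} = 1 by have := h0.card_pos; omega)
    have hk' : ∀ i, i ≠ k → c i = 0 := by
      intro i hi
      by_contra hci
      have : i ∈ univ.filter fun i => c i ≠ 0 := by simpa using hci
      rw [hk, mem_singleton] at this
      exact hi this
    rw [sum_eq_single k (fun i _ hi => hk' i hi) (by simp)] at hempty
    rw [sum_eq_single k (fun i _ hi => by rw [hk' i hi, zero_smul]) (by simp), hempty,
      one_smul] at hc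
    exact (hne k).1 hc.symm
  obtain ⟨f, hf⟩ := exists_image_univ_eq h0 (not_le.1 hs).le
  refine ⟨f, c, fun i hi => ?_, h2, u, hc.symm⟩
  rw [hf] at hi
  simpa using hi

theorem succ_le_binomSum (s : ℕ) {d : ℕ} (hd : 0 < d) : s + 1 ≤ binomSum s d := by
  calc s + 1 = ∑ k ∈ range 2, s.choose k := by simp [sum_range_succ, add_comm]
    _ ≤ binomSum s d := sum_le_sum_of_subset (range_subset_range.2 (by omega))

theorem binomSum_le_pow (N d : ℕ) : binomSum N d ≤ (N + 1) ^ d := by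
  rw [add_pow, binomSum]
  refine sum_le_sum fun k hk => ?_
  have h1 : 0 < d.choose k := Nat.choose_pos (by simpa [Nat.lt_succ_iff] using hk)
  simp only [one_pow, mul_one]
  exact (Nat.choose_le_pow N k).trans (Nat.le_mul_of_pos_right _ h1)

open Classical in
-- Two cut points are used: `a` for large supports, `a'` for each of the `m ^ s` small ones. In the
-- latter `s` replaces `N`, as `s ≤ binomSum s d`.
theorem card_hasExtraPower_le {m n d N s a q a' q' : ℕ} (hd : 0 < d) (hs : 0 < s)
    (hm : m ≤ binomSum N d) (h : a + q = n) (h' : a' + q' = n) :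
    (#{X : Fin m → Fin n → Bool | HasExtraPower d X} : ℝ) ≤
      2 ^ (m * n) * ((m * 2 ^ N / 2 ^ a + 2 ^ a * (2 / √s) ^ q) +
        m ^ s * (s * 2 ^ s / 2 ^ a' + 2 ^ a' * (3 / 4) ^ q')) := by
  have h1 : (#{X : Fin m → Fin n → Bool | HasCombination d univ s X} : ℝ) ≤
      2 ^ (m * n) * (m * 2 ^ N / 2 ^ a + 2 ^ a * (2 / √s) ^ q) := by
    subst h
    have := card_hasCombination_le (a := a) (q := q) hd (univ : Finset (Fin m)) s N
      (by simpa using hm) (2 / √s) (by positivity)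
      fun c hc => card_signed_sum_eq_one_or_le_sqrt c s hs hc
    simpa using this
  have h2 : ∀ f : Fin s → Fin m,
      (#{X : Fin m → Fin n → Bool | HasCombination d (univ.image f) 2 X} : ℝ) ≤
      2 ^ (m * n) * (s * 2 ^ s / 2 ^ a' + 2 ^ a' * (3 / 4) ^ q') := by
    intro f
    subst h'
    have hcard : #(univ.image f) ≤ s := card_image_le.trans (by simp)
    refine (card_hasCombination_le (a := a') (q := q') hd (univ.image f) 2 s
      (hcard.trans ((Nat.le_succ s).trans (succ_le_binomSum s hd))) (3 / 4) (by norm_num)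
      fun c hc => card_signed_sum_eq_one_or_le_three_quarters c hc).trans ?_
    gcongr
  have hsub : univ.filter (fun X : Fin m → Fin n → Bool => HasExtraPower d X) ⊆
      univ.filter (fun X => HasCombination d univ s X) ∪
      (univ : Finset (Fin s → Fin m)).biUnion fun f =>
        univ.filter fun X => HasCombination d (univ.image f) 2 X := by
    intro X hX
    rw [mem_union, mem_biUnion]
    rcases (mem_filter.1 hX).2.hasCombination s with h | ⟨f, h⟩
    · exact Or.inl (mem_filter.2 ⟨mem_univ _, h⟩)
    · exact Or.inr ⟨f, mem_univ _, mem_filter.2 ⟨mem_univ _, h⟩⟩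
  have h3 := (card_le_card hsub).trans ((card_union_le _ _).trans
    (Nat.add_le_add_left card_biUnion_le _))
  calc _ ≤ (#{X : Fin m → Fin n → Bool | HasCombination d univ s X} : ℝ) +
        ∑ f : Fin s → Fin m,
          (#{X : Fin m → Fin n → Bool | HasCombination d (univ.image f) 2 X} : ℝ) := by
        exact_mod_cast h3
    _ ≤ 2 ^ (m * n) * (m * 2 ^ N / 2 ^ a + 2 ^ a * (2 / √s) ^ q) +
        ∑ f : Fin s → Fin m, 2 ^ (m * n) * (s * 2 ^ s / 2 ^ a' + 2 ^ a' * (3 / 4) ^ q' : ℝ) :=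
        add_le_add h1 (sum_le_sum fun f _ => h2 f)
    _ = _ := by
        rw [sum_const, nsmul_eq_mul]
        simp only [card_univ, Fintype.card_pi, Fintype.card_fin, prod_const]
        push_cast
        ring

/-! ### Numerical estimates -/

theorem linear_le_exp_div_hundred {L : ℝ} (hL : 10000 ≤ L) : 32 * L ≤ Real.exp (L / 100) := by
  have h := Real.pow_div_factorial_le_exp (L / 100) (by linarith) 4
  norm_num [Nat.factorial] at h
  have h1 : (10000 : ℝ) ^ 3 * L ≤ L ^ 3 * L := by gcongr
  nlinarith

/-- `log n` beats the constants, and `s` is about `n ^ 0.01`. -/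
structure ResilienceParameters (n d m s : ℕ) (t L : ℝ) : Prop where
  one_le_degree : (1 : ℝ) ≤ d
  large : 10000 ≤ L
  exp_log : Real.exp L = n
  degree_mul_le : (d : ℝ) * Real.exp (L / 50) ≤ t
  le_mul : t ≤ 0.001 * n
  card_le : m ≤ (n + 1) ^ d
  lower : Real.exp (L / 100) ≤ s
  upper : (s : ℝ) ≤ Real.exp (L / 100) + 1

namespace ResilienceParameters

variable {n d m s : ℕ} {t L : ℝ}

theorem exp_fifty_le (h : ResilienceParameters n d m s t L) : Real.exp (L / 50) ≤ t :=
  (le_mul_of_one_le_left (Real.exp_pos _).le h.one_le_degree).trans h.degree_mul_le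

theorem two_hundred_le (h : ResilienceParameters n d m s t L) : 200 ≤ t := by
  have := h.exp_fifty_le
  have := Real.add_one_le_exp (L / 50)
  have := h.large
  linarith

theorem one_le_s (h : ResilienceParameters n d m s t L) : (1 : ℝ) ≤ s := by
  have := h.lower
  have := Real.add_one_le_exp (L / 100)
  have := h.large
  linarith

theorem s_le_two_mul (h : ResilienceParameters n d m s t L) : (s : ℝ) ≤ 2 * Real.exp (L / 100) := by
  have := h.upper
  have := Real.add_one_le_exp (L / 100)
  have := h.large
  linarith

theorem s_le (h : ResilienceParameters n d m s t L) : (s : ℝ) ≤ 2 * t := by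
  have h1 := h.s_le_two_mul
  have h2 : Real.exp (L / 100) ≤ Real.exp (L / 50) :=
    Real.exp_le_exp.2 (by linarith [h.large])
  linarith [h.exp_fifty_le]

/-- Here `m ^ s ≤ exp (2 * L * d * s)` with `s` about `exp (L / 100)`, while `t ≥ d * exp (L / 50)`.
The spare factor `exp (L / 100)` absorbs `32 * L`. -/
theorem pow_le (h : ResilienceParameters n d m s t L) : (m : ℝ) ^ s ≤ Real.exp (t / 8) := by
  have hL := h.large
  have hn : (1 : ℝ) ≤ n := by rw [← h.exp_log]; exact Real.one_le_exp (by linarith)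
  have h1 : (n : ℝ) + 1 ≤ Real.exp (2 * L) := by
    rw [two_mul, Real.exp_add, h.exp_log]
    have : (2 : ℝ) ≤ n := by
      rw [← h.exp_log]
      linarith [Real.add_one_le_exp L]
    nlinarith
  have hm : (m : ℝ) ≤ Real.exp (2 * L) ^ d := by
    calc (m : ℝ) ≤ ((n : ℝ) + 1) ^ d := by exact_mod_cast h.card_le
      _ ≤ _ := by gcongr
  calc (m : ℝ) ^ s ≤ (Real.exp (2 * L) ^ d) ^ s := by gcongr
    _ = Real.exp (s * (d * (2 * L))) := by rw [Real.exp_nat_mul, Real.exp_nat_mul]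
    _ ≤ Real.exp (t / 8) := by
      refine Real.exp_le_exp.2 ?_
      have h2 := h.degree_mul_le
      rw [show L / 50 = L / 100 + L / 100 by ring, Real.exp_add] at h2
      have h3 := linear_le_exp_div_hundred hL
      have h4 := h.s_le_two_mul
      have hd := h.one_le_degree
      calc (s : ℝ) * (d * (2 * L)) ≤ (2 * Real.exp (L / 100)) * (d * (2 * L)) := by gcongr
        _ = (d * Real.exp (L / 100)) * (32 * L) / 8 := by ring
        _ ≤ (d * Real.exp (L / 100)) * Real.exp (L / 100) / 8 := by gcongr
        _ ≤ t / 8 := by linarith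

theorem le_exp (h : ResilienceParameters n d m s t L) : (m : ℝ) ≤ Real.exp (t / 8) := by
  rcases Nat.eq_zero_or_pos m with rfl | hm
  · simpa using (Real.exp_pos _).le
  refine le_trans ?_ h.pow_le
  exact le_self_pow₀ (by exact_mod_cast hm) (by
    have := h.one_le_s
    rintro rfl
    norm_num at this)

theorem log_le (h : ResilienceParameters n d m s t L) : L ≤ n := by
  rw [← h.exp_log]
  linarith [Real.add_one_le_exp L]

theorem two_pow_eq_exp (k : ℕ) : (2 : ℝ) ^ k = Real.exp (k * Real.log 2) := by
  rw [Real.exp_nat_mul, Real.exp_log two_pos]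

theorem dependent_bound (h : ResilienceParameters n d m s t L) {N a : ℕ} (hNa : (N : ℝ) + t ≤ a) :
    (m : ℝ) * 2 ^ N / 2 ^ a ≤ Real.exp (-(t / 5)) := by
  have ht := h.two_hundred_le
  have hl := Real.log_two_gt_d9
  calc (m : ℝ) * 2 ^ N / 2 ^ a ≤ Real.exp (t / 8) * 2 ^ N / 2 ^ a := by
        gcongr; exact h.le_exp
    _ = Real.exp (t / 8 + N * Real.log 2 - a * Real.log 2) := by
        rw [two_pow_eq_exp, two_pow_eq_exp, Real.exp_sub, Real.exp_add]
    _ ≤ _ := Real.exp_le_exp.2 (by nlinarith)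

/-- Each tail coordinate gains `exp (-L / 250)`, the factor `2` being absorbed by `exp (L / 1000)`.
Since `q * L ≥ 5000 * n`, the total gain `exp (-20 * n)` beats `2 ^ a`. -/
theorem many_coefficients_bound (h : ResilienceParameters n d m s t L) {a q : ℕ} (ha : a ≤ n)
    (hq : 10000 * (n : ℝ) / L < q + 1) :
    (2 : ℝ) ^ a * (2 / √s) ^ q ≤ Real.exp (-(t / 5)) := by
  have hL := h.large
  have hL0 : 0 < L := by linarith
  have ht := h.two_hundred_le
  have hl := Real.log_two_lt_d9
  have hl' := Real.log_two_gt_d9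
  have hn := h.log_le
  have hsq : Real.exp (L / 200) ≤ √s := by
    refine Real.le_sqrt_of_sq_le ?_
    rw [← Real.exp_nat_mul]
    refine le_trans (le_of_eq ?_) h.lower
    congr 1
    push_cast
    ring
  have hk : 2 / √(s : ℝ) ≤ Real.exp (-(L / 250)) := by
    calc 2 / √(s : ℝ) ≤ 2 / Real.exp (L / 200) := by gcongr
      _ = Real.exp (Real.log 2 - L / 200) := by rw [Real.exp_sub, Real.exp_log two_pos]
      _ ≤ _ := Real.exp_le_exp.2 (by linarith)
  have hqL : 5000 * (n : ℝ) ≤ q * L := by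
    rw [div_lt_iff₀ hL0] at hq
    linarith
  have ha' : (a : ℝ) ≤ n := by exact_mod_cast ha
  calc (2 : ℝ) ^ a * (2 / √s) ^ q ≤ 2 ^ a * Real.exp (-(L / 250)) ^ q := by gcongr
    _ = Real.exp (a * Real.log 2 + q * (-(L / 250))) := by
        rw [two_pow_eq_exp, Real.exp_add, Real.exp_nat_mul _ q]
    _ ≤ _ := Real.exp_le_exp.2 (by nlinarith [h.le_mul])

theorem few_dependent_bound (h : ResilienceParameters n d m s t L) :
    (m : ℝ) ^ s * (s * 2 ^ s / 2 ^ (n / 10)) ≤ Real.exp (-(t / 5)) := by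
  have ht := h.two_hundred_le
  have hl := Real.log_two_lt_d9
  have hl' := Real.log_two_gt_d9
  have hs := h.s_le
  have htn := h.le_mul
  have hs2 : (s : ℝ) ≤ 2 ^ s := by exact_mod_cast Nat.lt_two_pow_self.le
  have hdiv : (n : ℝ) / 10 - 1 ≤ (n / 10 : ℕ) := by
    have : n < 10 * (n / 10) + 10 := by omega
    have : (n : ℝ) < 10 * (n / 10 : ℕ) + 10 := by exact_mod_cast this
    linarith
  calc (m : ℝ) ^ s * (s * 2 ^ s / 2 ^ (n / 10))
      ≤ Real.exp (t / 8) * (2 ^ s * 2 ^ s / 2 ^ (n / 10)) := by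
        gcongr; exact h.pow_le
    _ = Real.exp (t / 8 + (s * Real.log 2 + s * Real.log 2 - (n / 10 : ℕ) * Real.log 2)) := by
        rw [two_pow_eq_exp, two_pow_eq_exp, Real.exp_add, Real.exp_sub, Real.exp_add]
    _ ≤ _ := by
        refine Real.exp_le_exp.2 ?_
        have h1 : (s : ℝ) * Real.log 2 ≤ 2 * t * 0.7 :=
          mul_le_mul hs (by linarith) (by linarith) (by linarith)
        have h2 : ((n : ℝ) / 10 - 1) * 0.69 ≤ (n / 10 : ℕ) * Real.log 2 :=
          mul_le_mul hdiv (by linarith) (by norm_num) (by positivity)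
        linarith

theorem few_coefficients_bound (h : ResilienceParameters n d m s t L) :
    (m : ℝ) ^ s * (2 ^ (n / 10) * (3 / 4) ^ (n - n / 10)) ≤ Real.exp (-(t / 5)) := by
  have ht := h.two_hundred_le
  have hl := Real.log_two_lt_d9
  have hl' := Real.log_two_gt_d9
  have htn := h.le_mul
  have hdiv : ((n / 10 : ℕ) : ℝ) ≤ n / 10 := Nat.cast_div_le
  have hsub : ((n - n / 10 : ℕ) : ℝ) = n - (n / 10 : ℕ) := Nat.cast_sub (Nat.div_le_self _ _)
  have h34 : (3 / 4 : ℝ) ≤ Real.exp (-(1 / 4)) := by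
    linarith [Real.add_one_le_exp (-(1 / 4) : ℝ)]
  calc (m : ℝ) ^ s * (2 ^ (n / 10) * (3 / 4) ^ (n - n / 10))
      ≤ Real.exp (t / 8) * (2 ^ (n / 10) * Real.exp (-(1 / 4)) ^ (n - n / 10)) := by
        gcongr; exact h.pow_le
    _ = Real.exp (t / 8 + ((n / 10 : ℕ) * Real.log 2 + (n - n / 10 : ℕ) * (-(1 / 4)))) := by
        rw [two_pow_eq_exp, Real.exp_add, Real.exp_add, Real.exp_nat_mul _ (n - n / 10)]
    _ ≤ _ := by
        refine Real.exp_le_exp.2 ?_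
        rw [hsub]
        have h1 : ((n / 10 : ℕ) : ℝ) * Real.log 2 ≤ n / 10 * 0.7 :=
          mul_le_mul hdiv (by linarith) (by linarith) (by positivity)
        linarith

/-- The rate `1 / 5` exceeds `log 2 / 4 ≈ 0.173`, with room for the four error terms. -/
theorem four_mul_exp_lt (h : ResilienceParameters n d m s t L) :
    4 * Real.exp (-(t / 5)) < (2 : ℝ) ^ (-t / 4) := by
  have ht := h.two_hundred_le
  have hl := Real.log_two_lt_d9
  rw [Real.rpow_def_of_pos two_pos]
  have h1 : (4 : ℝ) < Real.exp (t / 40) := by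
    linarith [Real.add_one_le_exp (t / 40)]
  calc 4 * Real.exp (-(t / 5)) < Real.exp (t / 40) * Real.exp (-(t / 5)) := by
        gcongr
    _ = Real.exp (t / 40 - t / 5) := by rw [← Real.exp_add]; ring_nf
    _ ≤ _ := Real.exp_le_exp.2 (by nlinarith)

open Classical in
theorem card_hasExtraPower_lt (h : ResilienceParameters n d m s t L) {N q : ℕ}
    (hm : m ≤ binomSum N d) (hqn : q ≤ n) (hq : 10000 * (n : ℝ) / L < q + 1)
    (hN : (N : ℝ) + t + q ≤ n) :
    (#{X : Fin m → Fin n → Bool | HasExtraPower d X} : ℝ) <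
      2 ^ (m * n) * (2 : ℝ) ^ (-t / 4) := by
  have hd : 0 < d := by
    have := h.one_le_degree
    exact_mod_cast lt_of_lt_of_le one_pos this
  have hs : 0 < s := by
    have := h.one_le_s
    exact_mod_cast lt_of_lt_of_le one_pos this
  refine (card_hasExtraPower_le hd hs hm (Nat.sub_add_cancel hqn)
    (Nat.add_sub_cancel' (Nat.div_le_self n 10))).trans_lt ?_
  gcongr
  have h1 := h.dependent_bound (N := N) (a := n - q) (by rw [Nat.cast_sub hqn]; linarith)
  have h2 := h.many_coefficients_bound (Nat.sub_le n q) hq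
  have h3 := h.few_dependent_bound
  have h4 := h.few_coefficients_bound
  have h5 := h.four_mul_exp_lt
  rw [mul_add]
  linarith

end ResilienceParameters

/-! ### From counting to probability -/

theorem boolSign_comp_mem_signCube {n : ℕ} (b : Fin n → Bool) : boolSign ∘ b ∈ signCube n :=
  fun i => (boolSign_eq_or (b i)).symm

theorem boolSign_comp_injective {n : ℕ} :
    Function.Injective fun b : Fin n → Bool => boolSign ∘ b :=
  boolSign_injective.comp_left

theorem signCube_eq_range (n : ℕ) :
    signCube n = Set.range fun b : Fin n → Bool => boolSign ∘ b := by
  ext x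
  constructor
  · intro hx
    refine ⟨fun i => decide (x i = 1), ?_⟩
    funext i
    rcases hx i with h | h <;> norm_num [boolSign, h]
  · rintro ⟨b, rfl⟩
    exact boolSign_comp_mem_signCube b

theorem uniformOn_signCube_singleton {n : ℕ} (b : Fin n → Bool) :
    uniformOn (signCube n) {boolSign ∘ b} = (2 ^ n)⁻¹ := by
  classical
  have hcube : signCube n =
      ((univ.image fun b : Fin n → Bool => boolSign ∘ b : Finset (Fin n → ℝ)) : Set _) := by
    rw [signCube_eq_range]; simp
  have hmeas : MeasurableSet (signCube n) := by rw [hcube]; exact Finset.measurableSet _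
  rw [uniformOn, cond_apply hmeas,
    Set.inter_eq_self_of_subset_right (Set.singleton_subset_iff.2 (boolSign_comp_mem_signCube b)),
    Measure.count_singleton, mul_one, hcube, Measure.count_apply_finset,
    card_image_of_injective _ boolSign_comp_injective]
  simp

section

variable {m n : ℕ} {Ω : Type*} [MeasurableSpace Ω] {P : Measure Ω}
  {x : Fin m → Ω → (Fin n → ℝ)}

theorem measure_forall_eq_boolSign (hindep : iIndepFun x P)
    (hlaw : ∀ k, HasLaw (x k) (uniformOn (signCube n)) P) (X : Fin m → Fin n → Bool) :
    P {ω | ∀ k, x k ω = boolSign ∘ X k} = (2 ^ (m * n))⁻¹ := by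
  have h := hindep.measure_inter_preimage_eq_mul univ (sets := fun k => {boolSign ∘ X k})
    fun k _ => measurableSet_singleton _
  have hset : (⋂ k ∈ (univ : Finset (Fin m)), x k ⁻¹' {boolSign ∘ X k}) =
      {ω | ∀ k, x k ω = boolSign ∘ X k} := by
    ext ω; simp
  rw [hset] at h
  have hk : ∀ k, P (x k ⁻¹' {boolSign ∘ X k}) = (2 ^ n)⁻¹ := by
    intro k
    rw [← Measure.map_apply_of_aemeasurable (hlaw k).aemeasurable (measurableSet_singleton _),
      (hlaw k).map_eq, uniformOn_signCube_singleton]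
  rw [h]
  simp only [hk, prod_const, card_univ, Fintype.card_fin]
  rw [← ENNReal.inv_pow, ← pow_mul, mul_comm n m]

open Classical in
/-- The probability of an event is at least the proportion of the sign patterns that entail it. -/
theorem card_div_le_measureReal [IsProbabilityMeasure P] (hindep : iIndepFun x P)
    (hlaw : ∀ k, HasLaw (x k) (uniformOn (signCube n)) P)
    (good : Finset (Fin m → Fin n → Bool)) (E : Set Ω)
    (hE : ∀ X ∈ good, ∀ ω, (∀ k, x k ω = boolSign ∘ X k) → ω ∈ E) :
    (#good : ℝ) / 2 ^ (m * n) ≤ P.real E := by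
  have hU : P (⋃ X ∈ good, {ω | ∀ k, x k ω = boolSign ∘ X k}) = #good * (2 ^ (m * n))⁻¹ := by
    -- The `x k` are only almost everywhere measurable, hence null-measurable sets.
    rw [measure_biUnion_finset₀]
    · simp only [measure_forall_eq_boolSign hindep hlaw, sum_const, nsmul_eq_mul]
    · intro X _ X' _ hne
      refine Disjoint.aedisjoint (Set.disjoint_left.2 fun ω h h' => hne ?_)
      funext k
      exact boolSign_comp_injective ((h k).symm.trans (h' k))
    · intro X _
      rw [Set.ofPred_forall]
      exact NullMeasurableSet.iInter fun k =>
        (hlaw k).aemeasurable.nullMeasurableSet_preimage (measurableSet_singleton (boolSign ∘ X k))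
  -- Monotonicity needs no measurability of `E`.
  have hle : P.real (⋃ X ∈ good, {ω | ∀ k, x k ω = boolSign ∘ X k}) ≤ P.real E :=
    measureReal_mono (Set.iUnion₂_subset fun X hX ω hω => hE X hX ω hω)
  refine le_trans (le_of_eq ?_) hle
  rw [Measure.real, hU]
  simp [div_eq_mul_inv]

end

/-- As `binomSum 0 d ≤ 1 ≤ m`, the floor must be positive. This forces `10000 * n / log n < n`, so
`n` is automatically huge. -/
theorem ResilienceParameters.of_hypotheses {n d m : ℕ} {t : ℝ} (hn : 0 < n) (hd : 0 < d)
    (hm : 0 < m) (hdt : (d : ℝ) * (n : ℝ) ^ (0.02 : ℝ) ≤ t) (htn : t ≤ 0.001 * (n : ℝ))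
    (hmN : m < binomSum ⌊(n : ℝ) - 10000 * (n : ℝ) / Real.log (n : ℝ) - t⌋₊ d) :
    ResilienceParameters n d m ⌈Real.exp (Real.log n / 100)⌉₊ t (Real.log n) ∧
      0 < (n : ℝ) - 10000 * (n : ℝ) / Real.log (n : ℝ) - t := by
  have hn' : (0 : ℝ) < n := by exact_mod_cast hn
  have hn1 : (1 : ℝ) ≤ n := by exact_mod_cast hn
  have hd1 : (1 : ℝ) ≤ d := by exact_mod_cast hd
  have hpow : (n : ℝ) ^ (0.02 : ℝ) = Real.exp (Real.log n / 50) := by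
    rw [Real.rpow_def_of_pos hn']
    congr 1
    ring
  have hpow1 : (1 : ℝ) ≤ (n : ℝ) ^ (0.02 : ℝ) := Real.one_le_rpow hn1 (by norm_num)
  have ht1 : 1 ≤ t := le_trans (by nlinarith) hdt
  have hfloor : 0 < ⌊(n : ℝ) - 10000 * (n : ℝ) / Real.log (n : ℝ) - t⌋₊ := by
    by_contra h
    rw [Nat.eq_zero_of_not_pos h] at hmN
    have := binomSum_le_pow 0 d
    simp only [zero_add, one_pow] at this
    omega
  have hpos := Nat.pos_of_floor_pos hfloor
  have hL : 0 < Real.log n := Real.log_pos (by linarith)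
  refine ⟨⟨hd1, ?_, Real.exp_log hn', by rwa [← hpow], htn, ?_, Nat.le_ceil _,
    (Nat.ceil_lt_add_one (Real.exp_pos _).le).le⟩, hpos⟩
  · have h : 10000 * (n : ℝ) / Real.log n < n := by linarith
    rw [div_lt_iff₀ hL] at h
    nlinarith
  · refine hmN.le.trans ((binomSum_le_pow _ d).trans (Nat.pow_le_pow_left ?_ d))
    refine Nat.succ_le_succ (Nat.floor_le_of_le ?_)
    have : 0 ≤ 10000 * (n : ℝ) / Real.log n := by positivity
    linarith

theorem theorem4p2 :
    ∃ C : ℝ, 0 < C ∧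
      ∀ (n d m : ℕ) (t : ℝ), 0 < n → 0 < d → 0 < m →
        (d : ℝ) * (n : ℝ) ^ (0.02 : ℝ) ≤ t → t ≤ 0.001 * (n : ℝ) →
        m < binomSum ⌊(n : ℝ) - C * (n : ℝ) / Real.log (n : ℝ) - t⌋₊ d →
        ∀ (Ω : Type*) [MeasurableSpace Ω] (P : MeasureTheory.Measure Ω)
          [MeasureTheory.IsProbabilityMeasure P] (x : Fin m → Ω → (Fin n → ℝ)),
          ProbabilityTheory.iIndepFun x P →
          (∀ k, ProbabilityTheory.HasLaw (x k) (ProbabilityTheory.uniformOn (signCube n)) P) →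
          1 - (2 : ℝ) ^ (-t / 4) <
            P.real {ω | ∀ u ∈ signCube n,
              powLE d u ∈ Submodule.span ℝ (Set.range fun k => powLE d (x k ω)) →
              ∃ k, powLE d u = powLE d (x k ω) ∨ powLE d u = -powLE d (x k ω)} := by
  classical
  refine ⟨10000, by norm_num, fun n d m t hn hd hm hdt htn hmN Ω _ P _ x hindep hlaw => ?_⟩
  obtain ⟨h, hpos⟩ := ResilienceParameters.of_hypotheses hn hd hm hdt htn hmN
  have hL := h.large
  have ht := h.two_hundred_le
  have hq0 : 0 ≤ 10000 * (n : ℝ) / Real.log n := by positivity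
  have hqle := Nat.floor_le hq0
  -- Taking `q` as the floor of the loss term in `N` gives `N + t + q ≤ n`.
  have hbad := h.card_hasExtraPower_lt (q := ⌊10000 * (n : ℝ) / Real.log n⌋₊) hmN.le
    (Nat.floor_le_of_le (by linarith)) (Nat.lt_floor_add_one _)
    (by linarith [Nat.floor_le hpos.le])
  have hgood := card_div_le_measureReal hindep hlaw
    (univ.filter fun X : Fin m → Fin n → Bool => ¬ HasExtraPower d X)
    {ω | ∀ u ∈ signCube n,
      powLE d u ∈ Submodule.span ℝ (Set.range fun k => powLE d (x k ω)) →
      ∃ k, powLE d u = powLE d (x k ω) ∨ powLE d u = -powLE d (x k ω)} ?_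
  · refine lt_of_lt_of_le ?_ hgood
    have hsum := card_filter_add_card_filter_not (s := (univ : Finset (Fin m → Fin n → Bool)))
      (HasExtraPower d)
    have hcard : #(univ : Finset (Fin m → Fin n → Bool)) = 2 ^ (m * n) := by
      simp [pow_mul, mul_comm m n]
    rw [hcard] at hsum
    have hsum' : (#{X : Fin m → Fin n → Bool | HasExtraPower d X} : ℝ) +
        #{X : Fin m → Fin n → Bool | ¬ HasExtraPower d X} = 2 ^ (m * n) := by exact_mod_cast hsum
    rw [lt_div_iff₀ (by positivity)]
    linarith
  · intro X hX ω hω u hu huspan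
    by_contra! hc
    simp only [hω] at huspan hc
    rw [signCube_eq_range] at hu
    obtain ⟨b, rfl⟩ := hu
    exact (mem_filter.1 hX).2 ⟨b, huspan, hc⟩
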